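/- Let $D\ge 1$ be an integer. On $\mathbb C^D$, with $|x|^2=\sum_{\ell=1}^D|x^{(\ell)}|^2$ and Lebesgue measure $dx$ (the product of the area measures of the $D$ coordinates), let $\lambda_D(dx)=\pi^{-D}e^{-|x|^2}\,dx$ and $$K_D(x,y)=e^{x\cdot\overline{y}},\qquad x\cdot\overline y=\sum_{\ell=1}^D x^{(\ell)}\overline{y^{(\ell)}} .$$ Let $\Xi=\sum_i\delta_{X_i}$ be the Heisenberg determinantal point process on $\mathbb C^D$, that is, a simple point process, almost surely without repeated points and finite on bounded sets, such that for every $n\ge1$ the function $\rho_n(x_1,\dots,x_n)=\det[K_D(x_i,x_j)]_{1\le i,j\le n}$ is its $n$-th correlation function with respect to $\lambda_D$: for every bounded measurable $\varphi:(\mathbb C^D)^n\to\mathbb C$ of compact support, $$\mathbb E\Big[\sum_{i_1,\dots,i_n\ \text{distinct}}\varphi(X_{i_1},\dots,X_{i_n})\Big]=\int_{(\mathbb C^D)^n}\varphi\,\rho_n\,d\lambda_D^{\otimes n},$$ both sides being absolutely convergent. Let $$ {}_2F_2(a_1,a_2;b_1,b_2;x)=\sum_{n=0}^\infty\frac{(a_1)_n(a_2)_n}{(b_1)_n(b_2)_n}\frac{x^n}{n!},\qquad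 (a)_0=1,\quad (a)_n=a(a+1)\cdots(a+n-1).$$ Then for every $R>0$, with $B_R=\{x\in\mathbb C^D:|x|<R\}$, the random variable $\Xi(B_R)$ is square integrable, the hypergeometric series below converges absolutely, and $$\operatorname{Var}[\Xi(B_R)]=\frac{R^{2D}}{\Gamma(D+1)}\left[1-\frac{R^{2D}}{\Gamma(D+1)}\;{}_2F_2\!\left(D,\,D+\tfrac12;\,D+1,\,2D+1;\,-4R^2\right)\right].$$ -/

import Mathlib

open MeasureTheory ProbabilityTheory

noncomputable section

/-- A locally finite configuration of points of `S`, repetitions allowed: `mult x` is the number of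
points at the site `x`, and every bounded set contains only finitely many points. -/
structure Configuration (S : Type*) [PseudoMetricSpace S] where
  mult : S → ℕ
  finite_of_isBounded : ∀ Λ : Set S, Bornology.IsBounded Λ → {x ∈ Λ | mult x ≠ 0}.Finite

namespace Configuration

/-- The index set of the points of `ξ`: a site `x` carries `mult x` indices.
The point with index `i` is `i.1`. -/
abbrev Index {S : Type*} [PseudoMetricSpace S] (ξ : Configuration S) : Type _ :=
  Σ x : S, Fin (ξ.mult x)

/-- The counting measure `∑ᵢ δ_{xᵢ}` of a configuration. -/
def measure {S : Type*} [PseudoMetricSpace S] [MeasurableSpace S] (ξ : Configuration S) :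
    Measure S :=
  Measure.sum fun i : ξ.Index => Measure.dirac i.1

/-- The measure `ξₙ = ∑ δ_{(x_{i₁}, …, x_{iₙ})}` on `Sⁿ`, where the sum runs over all `n`-tuples of
pairwise distinct indices. -/
def factorialMeasure {S : Type*} [PseudoMetricSpace S] [MeasurableSpace S] (ξ : Configuration S)
    (n : ℕ) : Measure (Fin n → S) :=
  Measure.sum fun e : Fin n ↪ ξ.Index => Measure.dirac fun j => (e j).1

/-- No site carries more than one point. -/
def IsSimple {S : Type*} [PseudoMetricSpace S] (ξ : Configuration S) : Prop :=
  ∀ x, ξ.mult x ≤ 1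

/-- The σ-algebra on configurations generated by the counts `ξ ↦ ξ(A)`, `A` measurable. -/
instance {S : Type*} [PseudoMetricSpace S] [MeasurableSpace S] :
    MeasurableSpace (Configuration S) :=
  MeasurableSpace.comap Configuration.measure inferInstance

end Configuration

/-- `ρ` is an `n`-th correlation function, with respect to the reference measure `lam`, of the
point process `Ξ` defined on the probability space `(Ω, P)`: it is measurable, symmetric and
nonnegative, and `E[⟨Ξₙ, φ⟩] = ∫ φ ρ dlam^{⊗n}` for every bounded measurable `φ : Sⁿ → ℂ` of compact
support, where both sides exist as absolutely convergent integrals. -/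
structure IsCorrelationFunction {S Ω : Type*} [PseudoMetricSpace S] [MeasurableSpace S]
    [MeasurableSpace Ω] (P : Measure Ω) (Ξ : Ω → Configuration S) (lam : Measure S)
    (n : ℕ) (ρ : (Fin n → S) → ℝ) : Prop where
  measurable : Measurable ρ
  symmetric : ∀ (σ : Equiv.Perm (Fin n)) (x : Fin n → S), ρ (x ∘ σ) = ρ x
  nonneg : ∀ x, 0 ≤ ρ x
  integrable_left : ∀ φ : (Fin n → S) → ℂ, Measurable φ → (∃ C : ℝ, ∀ x, ‖φ x‖ ≤ C) →
    HasCompactSupport φ → Integrable (fun ω => ∫ x, φ x ∂((Ξ ω).factorialMeasure n)) P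
  integrable_right : ∀ φ : (Fin n → S) → ℂ, Measurable φ → (∃ C : ℝ, ∀ x, ‖φ x‖ ≤ C) →
    HasCompactSupport φ → Integrable (fun x => φ x * (ρ x : ℂ)) (Measure.pi fun _ => lam)
  integral_eq : ∀ φ : (Fin n → S) → ℂ, Measurable φ → (∃ C : ℝ, ∀ x, ‖φ x‖ ≤ C) →
    HasCompactSupport φ →
    ∫ ω, ∫ x, φ x ∂((Ξ ω).factorialMeasure n) ∂P =
      ∫ x, φ x * (ρ x : ℂ) ∂(Measure.pi fun _ => lam)

/-- `(Ξ, K, lam)` is a determinantal point process: `Ξ` is a simple point process whose `n`-th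
correlation function with respect to `lam` is `det [K (xᵢ, xⱼ)]`, for every `n ≥ 1`. -/
structure IsDPP {S Ω : Type*} [PseudoMetricSpace S] [MeasurableSpace S] [MeasurableSpace Ω]
    (P : Measure Ω) (Ξ : Ω → Configuration S) (K : S → S → ℂ) (lam : Measure S) : Prop where
  measurable : Measurable Ξ
  simple : ∀ᵐ ω ∂P, (Ξ ω).IsSimple
  measurable_kernel : Measurable (Function.uncurry K)
  correlation : ∀ n : ℕ, 1 ≤ n → ∃ ρ : (Fin n → S) → ℝ, IsCorrelationFunction P Ξ lam n ρ ∧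
    ∀ x : Fin n → S, (ρ x : ℂ) = (Matrix.of fun i j => K (x i) (x j)).det

/-- Lebesgue measure on `ℂ^D`: the product of `D` copies of the area measure of `ℂ`. -/
def complexLebesgue (D : ℕ) : Measure (EuclideanSpace ℂ (Fin D)) :=
  (Measure.pi fun _ : Fin D => (volume : Measure ℂ)).map (WithLp.toLp 2)

/-- The complex standard normal distribution `π^{-D} e^{-|x|²} dx` on `ℂ^D`. -/
def complexGaussian (D : ℕ) : Measure (EuclideanSpace ℂ (Fin D)) :=
  (complexLebesgue D).withDensity fun x => ENNReal.ofReal (Real.exp (-‖x‖ ^ 2) / Real.pi ^ D)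

/-- The kernel `e^{x · ȳ}` on `ℂ^D`. -/
def heisenbergKernel (D : ℕ) (x y : EuclideanSpace ℂ (Fin D)) : ℂ :=
  Complex.exp (∑ l, x l * (starRingEnd ℂ) (y l))

/-- `Ξ` is the determinantal point process on `ℂ^D` of the Heisenberg family. -/
def IsHeisenbergDPP {Ω : Type*} [MeasurableSpace Ω] (D : ℕ) (P : Measure Ω)
    (Ξ : Ω → Configuration (EuclideanSpace ℂ (Fin D))) : Prop :=
  IsDPP P Ξ (heisenbergKernel D) (complexGaussian D)

/-- The `n`-th term of the series `₂F₂(a₁, a₂; b₁, b₂; x)`; `(ascPochhammer ℝ n).eval a` is the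
Pochhammer symbol `(a)ₙ = a (a + 1) ⋯ (a + n - 1)`. -/
def hypergeometric2F2Term (a₁ a₂ b₁ b₂ x : ℝ) (n : ℕ) : ℝ :=
  ((ascPochhammer ℝ n).eval a₁ * (ascPochhammer ℝ n).eval a₂) /
    ((ascPochhammer ℝ n).eval b₁ * (ascPochhammer ℝ n).eval b₂) * (x ^ n / (n.factorial : ℝ))

/-- The hypergeometric function `₂F₂(a₁, a₂; b₁, b₂; x)`. -/
def hypergeometric2F2 (a₁ a₂ b₁ b₂ x : ℝ) : ℝ :=
  ∑' n : ℕ, hypergeometric2F2Term a₁ a₂ b₁ b₂ x n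

end

/-!
Let `N` be the number of points in the ball `B` of radius `R`. The factorial moments of `N` are
integrals of the correlation functions (`IsCorrelationFunction.integral_descFactorial`), so
`Var N = E[N] + E[N(N-1)] - E[N]²` only involves `ρ₁` and `ρ₂`. Against Lebesgue measure the
one-point intensity of the Heisenberg process is the constant `π^{-D}`, and the two-point intensity
is `π^{-2D} (1 - e^{-|x - y|²})`. Hence `Var N = vol(B) / π^D - π^{-2D} ∫∫_{B × B} e^{-|x - y|²}`,
and everything reduces to this double integral.

Expanding the exponential, one needs the moments `∫∫_{B × B} |x - y|^{2k}`
(`setIntegral_norm_sub_pow`). For a homogeneous function, polar coordinates show that the integral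
over a ball and the integral against `e^{-|x|²}` differ by a Gamma factor that only depends on the
degree (`pow_mul_integral_homogeneous_mul_gaussian`), and the same holds for bihomogeneous functions
of `(x, y)`. Replacing the ball by the Gaussian makes the moments trivial: by rotation invariance
(`integral_norm_sub_smul_pow_mul_gaussian`),
`∫∫ |x - t y|^{2k} e^{-|x|² - |y|²} = (1 + t²)^k ∫∫ |x|^{2k} e^{-|x|² - |y|²}`.
Comparing the coefficients of `t^m`, which collect the terms of bidegree `(2k - m, m)`, and
inserting the Gamma factors gives the moments over the ball as a finite sum of binomial coefficients over
factorials. Vandermonde's identity evaluates that sum, and the duplication formula for Pochhammer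
symbols identifies the resulting power series with the `₂F₂` series. Its absolute convergence comes
with the dominated convergence used to expand the exponential.
-/

/-! ### Polar coordinates for homogeneous functions -/

section Polar

variable {V : Type*} [NormedAddCommGroup V] [NormedSpace ℝ V] [FiniteDimensional ℝ V]
  [Nontrivial V] [MeasurableSpace V] [BorelSpace V] (μ : Measure V) [μ.IsAddHaarMeasure]

/-- A homogeneous function times a radial weight integrates to a product of a spherical and a
radial integral. No integrability is assumed, since the integral of a product function over a
product measure always factors. -/
theorem integral_homogeneous_mul_radial {m : ℕ} {q : V → ℝ}
    (hq : ∀ (r : ℝ), 0 < r → ∀ x, q (r • x) = r ^ m * q x) (w : ℝ → ℝ) :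
    ∫ x, q x * w ‖x‖ ∂μ = (∫ x : Metric.sphere (0 : V) 1, q x ∂μ.toSphere) *
      ∫ r in Set.Ioi (0 : ℝ), r ^ (Module.finrank ℝ V - 1 + m) * w r := by
  calc
    ∫ x, q x * w ‖x‖ ∂μ = ∫ x : ({(0)}ᶜ : Set V), q x.1 * w ‖x.1‖ ∂(μ.comap (↑)) := by
      rw [integral_subtype_comap (measurableSet_singleton _).compl fun x ↦ q x * w ‖x‖,
        restrict_compl_singleton]
    _ = ∫ x : Metric.sphere (0 : V) 1 × Set.Ioi (0 : ℝ), q x.1 * (x.2.1 ^ m * w x.2.1)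
          ∂μ.toSphere.prod (.volumeIoiPow (Module.finrank ℝ V - 1)) := by
      rw [← μ.measurePreserving_homeomorphUnitSphereProd.integral_comp
        (Homeomorph.measurableEmbedding _)]
      refine integral_congr_ae (.of_forall fun x => ?_)
      have hx : 0 < ‖x.1‖ := norm_pos_iff.2 x.2
      simp only [homeomorphUnitSphereProd_apply_snd_coe, homeomorphUnitSphereProd_apply_fst_coe]
      rw [hq _ (inv_pos.2 hx)]
      have h1 : ‖x.1‖⁻¹ ^ m * ‖x.1‖ ^ m = 1 := by
        rw [← mul_pow, inv_mul_cancel₀ hx.ne', one_pow]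
      linear_combination (-(q x.1 * w ‖x.1‖)) * h1
    _ = (∫ x : Metric.sphere (0 : V) 1, q x ∂μ.toSphere) *
          ∫ r : Set.Ioi (0 : ℝ), r.1 ^ m * w r.1 ∂(.volumeIoiPow (Module.finrank ℝ V - 1)) :=
      integral_prod_mul (fun x : Metric.sphere (0 : V) 1 => q x)
        (fun r : Set.Ioi (0 : ℝ) => r.1 ^ m * w r.1)
    _ = _ := by
      congr 1
      simp only [Measure.volumeIoiPow, ENNReal.ofReal]
      rw [integral_withDensity_eq_integral_smul,
        integral_subtype_comap measurableSet_Ioi fun a ↦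
          Real.toNNReal (a ^ (Module.finrank ℝ V - 1)) • (a ^ m * w a),
        setIntegral_congr_fun measurableSet_Ioi fun x hx ↦ ?_]
      · rw [NNReal.smul_def, Real.coe_toNNReal _ (pow_nonneg hx.out.le _), smul_eq_mul]
        ring
      · exact (measurable_subtype_coe.pow_const _).real_toNNReal

/-- The Gaussian integral and the integral over a ball of a homogeneous function differ by a
Gamma factor that depends only on the degree. -/
theorem pow_mul_integral_homogeneous_mul_gaussian {m : ℕ} {q : V → ℝ}
    (hq : ∀ (r : ℝ), 0 < r → ∀ x, q (r • x) = r ^ m * q x) {R : ℝ} (hR : 0 < R) :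
    R ^ (Module.finrank ℝ V + m) * ∫ x, q x * Real.exp (-‖x‖ ^ 2) ∂μ =
      Real.Gamma ((Module.finrank ℝ V + m : ℕ) / 2 + 1) * ∫ x in Metric.ball 0 R, q x ∂μ := by
  have hd : 0 < Module.finrank ℝ V := Module.finrank_pos
  have hn : Module.finrank ℝ V - 1 + m + 1 = Module.finrank ℝ V + m := by omega
  set n := Module.finrank ℝ V + m with hn'
  have hn0 : (0 : ℝ) < n := by exact_mod_cast (by omega : 0 < n)
  have h1 : ∫ r in Set.Ioi (0 : ℝ), r ^ (Module.finrank ℝ V - 1 + m) * Real.exp (-r ^ 2) =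
      (1 / 2) * Real.Gamma (n / 2) := by
    have := integral_rpow_mul_exp_neg_rpow (p := 2) (q := (Module.finrank ℝ V - 1 + m : ℕ))
      two_pos (by linarith [Nat.cast_nonneg (α := ℝ) (Module.finrank ℝ V - 1 + m)])
    simp only [Real.rpow_natCast, Real.rpow_two] at this
    rw [this, ← hn]
    push_cast
    rfl
  have h2 : ∫ r in Set.Ioi (0 : ℝ), r ^ (Module.finrank ℝ V - 1 + m) *
      (Set.Iio R).indicator (fun _ => (1 : ℝ)) r = R ^ n / n := by
    have : ∀ r : ℝ, r ^ (Module.finrank ℝ V - 1 + m) * (Set.Iio R).indicator (fun _ => (1 : ℝ)) r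
        = (Set.Iio R).indicator (fun r => r ^ (Module.finrank ℝ V - 1 + m)) r := by
      intro r
      by_cases h : r < R <;> simp [h]
    simp_rw [this]
    rw [setIntegral_indicator measurableSet_Iio, Set.Ioi_inter_Iio, ← integral_Ioc_eq_integral_Ioo,
      ← intervalIntegral.integral_of_le hR.le, integral_pow]
    rw [hn, ← hn, zero_pow (by omega), sub_zero]
    push_cast
    rfl
  have h3 : ∫ x in Metric.ball 0 R, q x ∂μ =
      ∫ x, q x * (Set.Iio R).indicator (fun _ => (1 : ℝ)) ‖x‖ ∂μ := by
    rw [← integral_indicator Metric.isOpen_ball.measurableSet]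
    refine integral_congr_ae (.of_forall fun x => ?_)
    by_cases h : ‖x‖ < R <;> simp [h]
  rw [h3, integral_homogeneous_mul_radial μ hq (fun r => Real.exp (-r ^ 2)),
    integral_homogeneous_mul_radial μ hq, h1, h2, Real.Gamma_add_one (by positivity)]
  field_simp

end Polar

/-! ### Gaussian integrals and rotations -/

section Gaussian

variable {V : Type*} [NormedAddCommGroup V] [InnerProductSpace ℝ V] [FiniteDimensional ℝ V]
  [MeasurableSpace V] [BorelSpace V] (μ : Measure V) [μ.IsAddHaarMeasure]

/-- An endomorphism of `V × V` that is orthogonal for the form `‖x‖² + ‖y‖²` preserves the product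
of Haar measures: the Haar scalar is `1` because the Euclidean unit ball is mapped to itself. -/
theorem measurePreserving_prod_of_norm_sq_eq (L : V × V →ₗ[ℝ] V × V)
    (hL : ∀ p, ‖(L p).1‖ ^ 2 + ‖(L p).2‖ ^ 2 = ‖p.1‖ ^ 2 + ‖p.2‖ ^ 2) :
    MeasurePreserving L (μ.prod μ) (μ.prod μ) ∧ MeasurableEmbedding L := by
  have hinj : Function.Injective L := by
    refine (injective_iff_map_eq_zero L).2 fun p hp => ?_
    have h := hL p
    rw [hp] at h
    simp only [Prod.fst_zero, Prod.snd_zero, norm_zero] at h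
    have h1 : ‖p.1‖ = 0 := by nlinarith [sq_nonneg ‖p.1‖, sq_nonneg ‖p.2‖]
    have h2 : ‖p.2‖ = 0 := by nlinarith [sq_nonneg ‖p.1‖, sq_nonneg ‖p.2‖]
    exact Prod.ext (norm_eq_zero.1 h1) (norm_eq_zero.1 h2)
  let e : (V × V) ≃L[ℝ] (V × V) := (LinearEquiv.ofInjectiveEndo L hinj).toContinuousLinearEquiv
  have he : (e : V × V → V × V) = L := rfl
  have hemb : MeasurableEmbedding L := he ▸ e.toHomeomorph.measurableEmbedding
  refine ⟨⟨hemb.measurable, ?_⟩, hemb⟩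
  have hhaar : (Measure.map e (μ.prod μ)).IsAddHaarMeasure := e.isAddHaarMeasure_map _
  rw [← he]
  have hs := Measure.isAddLeftInvariant_eq_smul (Measure.map e (μ.prod μ)) (μ.prod μ)
  set κ := Measure.addHaarScalarFactor (Measure.map e (μ.prod μ)) (μ.prod μ)
  -- `V × V` carries the sup norm, so the Euclidean unit ball is written out
  let S : Set (V × V) := {p | ‖p.1‖ ^ 2 + ‖p.2‖ ^ 2 < 1}
  have hSo : IsOpen S := isOpen_lt (by fun_prop) continuous_const
  have hS0 : (μ.prod μ) S ≠ 0 := (hSo.measure_pos _ ⟨0, by simp [S]⟩).ne'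
  have hSb : Bornology.IsBounded S := by
    refine Metric.isBounded_closedBall (x := (0 : V × V)) (r := 1) |>.subset fun p hp => ?_
    have hp' : ‖p.1‖ ^ 2 + ‖p.2‖ ^ 2 < 1 := hp
    rw [mem_closedBall_zero_iff, Prod.norm_def, sup_le_iff]
    constructor <;> nlinarith [sq_nonneg ‖p.1‖, sq_nonneg ‖p.2‖, norm_nonneg p.1, norm_nonneg p.2]
  have hSt : (μ.prod μ) S ≠ ⊤ := hSb.measure_lt_top.ne
  have hpre : e ⁻¹' S = S := by
    ext p
    simp only [S, he, Set.mem_preimage, Set.mem_ofPred_eq, hL]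
  have h := congrArg (fun ν => ν S) hs
  simp only [Measure.smul_apply] at h
  rw [he, hemb.map_apply, ← he] at h
  have h' : (μ.prod μ) S = κ • (μ.prod μ) S := by
    calc _ = (μ.prod μ) (e ⁻¹' S) := by rw [hpre]
      _ = _ := h
  have hκ : (κ : ENNReal) = 1 := by
    rw [ENNReal.smul_def, smul_eq_mul] at h'
    exact ((ENNReal.mul_eq_right hS0 hSt).1 h'.symm)
  have hκ' : κ = 1 := by exact_mod_cast hκ
  rw [hs, hκ', one_smul]

/-- The Gaussian moments of `x - t y` are those of `√(1 + t²) x`, by rotation invariance of the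
Gaussian measure on `V × V`. -/
theorem integral_norm_sub_smul_pow_mul_gaussian (k : ℕ) (t : ℝ) :
    ∫ p : V × V, ‖p.1 - t • p.2‖ ^ (2 * k) * Real.exp (-‖p.1‖ ^ 2) * Real.exp (-‖p.2‖ ^ 2)
        ∂μ.prod μ =
      (1 + t ^ 2) ^ k *
        ∫ p : V × V, ‖p.1‖ ^ (2 * k) * Real.exp (-‖p.1‖ ^ 2) * Real.exp (-‖p.2‖ ^ 2)
          ∂μ.prod μ := by
  have hpos : 0 < 1 + t ^ 2 := by positivity
  set c := Real.sqrt (1 + t ^ 2)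
  have hc : 0 < c := Real.sqrt_pos.2 hpos
  have hc2 : c ^ 2 = 1 + t ^ 2 := Real.sq_sqrt hpos.le
  -- the rotation `(x, y) ↦ ((x - t y) / c, (t x + y) / c)`
  let L : V × V →ₗ[ℝ] V × V :=
    (c⁻¹ • (LinearMap.fst ℝ V V - t • LinearMap.snd ℝ V V)).prod
      (c⁻¹ • (t • LinearMap.fst ℝ V V + LinearMap.snd ℝ V V))
  have hL1 : ∀ p, (L p).1 = c⁻¹ • (p.1 - t • p.2) := fun p => rfl
  have hL2 : ∀ p, (L p).2 = c⁻¹ • (t • p.1 + p.2) := fun p => rfl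
  have hL : ∀ p, ‖(L p).1‖ ^ 2 + ‖(L p).2‖ ^ 2 = ‖p.1‖ ^ 2 + ‖p.2‖ ^ 2 := by
    intro p
    rw [hL1, hL2, norm_smul, norm_smul, mul_pow, mul_pow, norm_sub_sq_real, norm_add_sq_real,
      norm_smul, norm_smul, inner_smul_left, inner_smul_right]
    simp only [norm_inv, Real.norm_eq_abs, inv_pow, sq_abs, mul_pow, hc2]
    simp only [conj_trivial]
    field_simp
    ring
  obtain ⟨hmp, hemb⟩ := measurePreserving_prod_of_norm_sq_eq μ L hL
  rw [← hmp.integral_comp hemb (fun p : V × V => ‖p.1‖ ^ (2 * k) * Real.exp (-‖p.1‖ ^ 2) *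
    Real.exp (-‖p.2‖ ^ 2)), ← integral_const_mul]
  refine integral_congr_ae (.of_forall fun p => ?_)
  simp only [mul_assoc, ← Real.exp_add]
  rw [show -‖(L p).1‖ ^ 2 + -‖(L p).2‖ ^ 2 = -‖p.1‖ ^ 2 + -‖p.2‖ ^ 2 by linarith [hL p], hL1,
    norm_smul, mul_pow, ← hc2, ← pow_mul, norm_inv, Real.norm_eq_abs, abs_of_pos hc, inv_pow,
    ← mul_assoc, ← mul_assoc, mul_inv_cancel₀ (by positivity), one_mul]

theorem integrable_norm_pow_mul_gaussian [Nontrivial V] (m : ℕ) :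
    Integrable (fun x : V => ‖x‖ ^ m * Real.exp (-‖x‖ ^ 2)) μ := by
  refine (integrable_fun_norm_addHaar μ (f := fun r => r ^ m * Real.exp (-r ^ 2))).2 ?_
  have h := (integrable_rpow_mul_exp_neg_mul_sq one_pos (s := (Module.finrank ℝ V - 1 + m : ℕ))
    (by linarith [Nat.cast_nonneg (α := ℝ) (Module.finrank ℝ V - 1 + m)])).integrableOn
      (s := Set.Ioi 0)
  refine h.congr (.of_forall fun r => ?_)
  simp only [Real.rpow_natCast, smul_eq_mul, pow_add, neg_mul, one_mul, mul_assoc]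

theorem integral_norm_pow_mul_gaussian [Nontrivial V] {D : ℕ} (hD : Module.finrank ℝ V = 2 * D)
    (k : ℕ) :
    ∫ x, ‖x‖ ^ (2 * k) * Real.exp (-‖x‖ ^ 2) ∂μ =
      μ.real (Metric.ball 0 1) * (D.factorial * D.ascFactorial k : ℕ) := by
  have hD0 : 0 < D := by have := Module.finrank_pos (R := ℝ) (M := V); omega
  rw [integral_fun_norm_addHaar μ (fun r => r ^ (2 * k) * Real.exp (-r ^ 2)), hD]
  have h := integral_rpow_mul_exp_neg_rpow (p := 2) (q := (2 * D - 1 + 2 * k : ℕ))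
      two_pos (by linarith [Nat.cast_nonneg (α := ℝ) (2 * D - 1 + 2 * k)])
  simp only [Real.rpow_natCast, Real.rpow_two] at h
  have e : (((2 * D - 1 + 2 * k : ℕ) : ℝ) + 1) / 2 = ((D + k - 1 : ℕ) : ℝ) + 1 := by
    rw [div_eq_iff two_ne_zero]
    exact_mod_cast (by omega : 2 * D - 1 + 2 * k + 1 = (D + k - 1 + 1) * 2)
  rw [e, Real.Gamma_nat_eq_factorial] at h
  simp only [smul_eq_mul, ← mul_assoc, ← pow_add]
  rw [h]
  obtain ⟨E, rfl⟩ : ∃ E, D = E + 1 := ⟨D - 1, by omega⟩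
  have h2 : (E + 1).factorial * (E + 1).ascFactorial k = (E + 1) * (E + 1 + k - 1).factorial := by
    rw [Nat.factorial_succ, mul_assoc, Nat.factorial_mul_ascFactorial]
    congr 2
    omega
  rw [h2]
  push_cast
  ring

end Gaussian

/-! ### Moments of the distance between two points of a ball -/

/-- An identity between two real polynomial functions is preserved by every linear functional,
that is, by replacing each power `t ^ m` with a constant `lam m`. -/
theorem sum_mul_eq_sum_mul_of_forall_sum_mul_pow_eq {ι κ : Type*} {s : Finset ι} {s' : Finset κ}
    {a : ι → ℝ} {b : κ → ℝ} {e : ι → ℕ} {f : κ → ℕ}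
    (h : ∀ t : ℝ, ∑ i ∈ s, a i * t ^ e i = ∑ j ∈ s', b j * t ^ f j) (lam : ℕ → ℝ) :
    ∑ i ∈ s, a i * lam (e i) = ∑ j ∈ s', b j * lam (f j) := by
  have hp : ∑ i ∈ s, Polynomial.monomial (e i) (a i) =
      ∑ j ∈ s', Polynomial.monomial (f j) (b j) :=
    Polynomial.funext fun t => by simpa [Polynomial.eval_finsetSum] using h t
  have := congrArg (Polynomial.lsum fun m => (LinearMap.mulRight ℝ (lam m))) hp
  simpa [Polynomial.sum_monomial_index] using this

section DistMonomial

variable {V : Type*} [NormedAddCommGroup V] [InnerProductSpace ℝ V]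

/-- The bihomogeneous monomial `‖x‖^(2i) ‖y‖^(2l) ⟪x, y⟫^n`. -/
def distMonomial (i l n : ℕ) (p : V × V) : ℝ :=
  ‖p.1‖ ^ (2 * i) * ‖p.2‖ ^ (2 * l) * inner ℝ p.1 p.2 ^ n

theorem continuous_distMonomial (i l n : ℕ) :
    Continuous (distMonomial i l n : V × V → ℝ) := by
  unfold distMonomial
  fun_prop

theorem abs_distMonomial_le (i l n : ℕ) (p : V × V) :
    |distMonomial i l n p| ≤ ‖p.1‖ ^ (2 * i + n) * ‖p.2‖ ^ (2 * l + n) := by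
  unfold distMonomial
  rw [abs_mul, abs_pow, abs_of_nonneg (by positivity : 0 ≤ ‖p.1‖ ^ (2 * i) * ‖p.2‖ ^ (2 * l))]
  calc _ ≤ ‖p.1‖ ^ (2 * i) * ‖p.2‖ ^ (2 * l) * (‖p.1‖ * ‖p.2‖) ^ n := by
        gcongr
        exact abs_real_inner_le_norm _ _
    _ = _ := by ring

/-- Pairs `(n, i)` indexing the monomials `distMonomial i (k - n - i) n` of `‖x - t y‖^(2k)`. -/
def distIndex (k : ℕ) : Finset (Σ _ : ℕ, ℕ) :=
  (Finset.range (k + 1)).sigma fun n => Finset.range (k - n + 1)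

/-- The coefficient of `distMonomial i (k - n - i) n` in `‖x - y‖^(2k)`. -/
def distCoeff (k : ℕ) (z : Σ _ : ℕ, ℕ) : ℝ :=
  (-2) ^ z.1 * (k.choose z.1) * ((k - z.1).choose z.2)

/-- The power of `t` attached to a monomial is its degree in the second variable. -/
theorem norm_sub_smul_pow_eq_sum (k : ℕ) (t : ℝ) (p : V × V) :
    ‖p.1 - t • p.2‖ ^ (2 * k) = ∑ z ∈ distIndex k,
      distCoeff k z * t ^ (z.1 + 2 * (k - z.1 - z.2)) *
        distMonomial z.2 (k - z.1 - z.2) z.1 p := by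
  have h : ‖p.1 - t • p.2‖ ^ 2 =
      -2 * t * inner ℝ p.1 p.2 + (‖p.1‖ ^ 2 + t ^ 2 * ‖p.2‖ ^ 2) := by
    rw [norm_sub_sq_real, norm_smul, mul_pow, Real.norm_eq_abs, sq_abs, inner_smul_right]
    ring
  rw [pow_mul, h, add_pow, distIndex, Finset.sum_sigma]
  refine Finset.sum_congr rfl fun n _ => ?_
  rw [add_pow, Finset.mul_sum, Finset.sum_mul]
  refine Finset.sum_congr rfl fun i _ => ?_
  simp only [distCoeff, distMonomial]
  ring

end DistMonomial

section Moments

variable {V : Type*} [NormedAddCommGroup V] [InnerProductSpace ℝ V] [FiniteDimensional ℝ V]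
  [MeasurableSpace V] [BorelSpace V] (μ : Measure V) [μ.IsAddHaarMeasure]

/-- Two-variable form of the comparison between Gaussian and ball integrals. -/
theorem pow_mul_integral_bihomogeneous_mul_gaussian [Nontrivial V] {m₁ m₂ : ℕ} {q : V × V → ℝ}
    (hq₁ : ∀ r : ℝ, 0 < r → ∀ x y, q (r • x, y) = r ^ m₁ * q (x, y))
    (hq₂ : ∀ r : ℝ, 0 < r → ∀ x y, q (x, r • y) = r ^ m₂ * q (x, y)) {R : ℝ} (hR : 0 < R)
    (hG : Integrable (fun p : V × V => q p * Real.exp (-‖p.1‖ ^ 2) * Real.exp (-‖p.2‖ ^ 2))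
      (μ.prod μ))
    (hB : IntegrableOn q (Metric.ball 0 R ×ˢ Metric.ball 0 R) (μ.prod μ)) :
    R ^ (Module.finrank ℝ V + m₁) * R ^ (Module.finrank ℝ V + m₂) *
        ∫ p : V × V, q p * Real.exp (-‖p.1‖ ^ 2) * Real.exp (-‖p.2‖ ^ 2) ∂μ.prod μ =
      Real.Gamma ((Module.finrank ℝ V + m₁ : ℕ) / 2 + 1) *
        Real.Gamma ((Module.finrank ℝ V + m₂ : ℕ) / 2 + 1) *
        ∫ p in Metric.ball 0 R ×ˢ Metric.ball 0 R, q p ∂μ.prod μ := by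
  rw [integral_prod _ hG, setIntegral_prod _ hB]
  -- compare the inner integrals first; their ball version is again homogeneous, of degree `m₁`
  have h1 : ∀ x, R ^ (Module.finrank ℝ V + m₂) *
      ∫ y, q (x, y) * Real.exp (-‖x‖ ^ 2) * Real.exp (-‖y‖ ^ 2) ∂μ =
      Real.Gamma ((Module.finrank ℝ V + m₂ : ℕ) / 2 + 1) *
        ((∫ y in Metric.ball 0 R, q (x, y) ∂μ) * Real.exp (-‖x‖ ^ 2)) := by
    intro x
    rw [← mul_assoc, ← pow_mul_integral_homogeneous_mul_gaussian μ (fun r hr y => hq₂ r hr x y) hR,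
      mul_assoc, ← integral_mul_const]
    congr 2
    ext y
    ring
  have h2 := pow_mul_integral_homogeneous_mul_gaussian μ (m := m₁)
    (q := fun x => ∫ y in Metric.ball 0 R, q (x, y) ∂μ)
    (fun r hr x => by simp_rw [hq₁ r hr, integral_const_mul]) hR
  rw [mul_assoc, ← integral_const_mul]
  simp_rw [h1]
  rw [integral_const_mul]
  linear_combination (Real.Gamma ((Module.finrank ℝ V + m₂ : ℕ) / 2 + 1)) * h2

theorem integrable_distMonomial_mul_gaussian [Nontrivial V] (i l n : ℕ) :
    Integrable (fun p : V × V => distMonomial i l n p * Real.exp (-‖p.1‖ ^ 2) *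
      Real.exp (-‖p.2‖ ^ 2)) (μ.prod μ) := by
  refine ((integrable_norm_pow_mul_gaussian μ (2 * i + n)).mul_prod
    (integrable_norm_pow_mul_gaussian μ (2 * l + n))).mono' ?_ (.of_forall fun p => ?_)
  · have := continuous_distMonomial (V := V) i l n
    exact (by fun_prop : Continuous fun p : V × V => distMonomial i l n p *
      Real.exp (-‖p.1‖ ^ 2) * Real.exp (-‖p.2‖ ^ 2)).aestronglyMeasurable
  · rw [Real.norm_eq_abs, abs_mul, abs_mul, Real.abs_exp, Real.abs_exp]
    calc _ ≤ ‖p.1‖ ^ (2 * i + n) * ‖p.2‖ ^ (2 * l + n) * Real.exp (-‖p.1‖ ^ 2) *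
          Real.exp (-‖p.2‖ ^ 2) := by
          gcongr
          exact abs_distMonomial_le i l n p
      _ = _ := by ring

theorem integrableOn_ball_prod_ball {f : V × V → ℝ} (hf : Continuous f) (R : ℝ) :
    IntegrableOn f (Metric.ball 0 R ×ˢ Metric.ball 0 R) (μ.prod μ) :=
  (hf.continuousOn.integrableOn_compact
    ((isCompact_closedBall (0 : V) R).prod (isCompact_closedBall (0 : V) R))).mono_set
    (Set.prod_mono Metric.ball_subset_closedBall Metric.ball_subset_closedBall)

/-- The moments of the distance between two points of a ball. In the expansion of
`‖x - t y‖^(2k)` into monomials, the total Gaussian integral is a multiple of `(1 + t²)^k`, and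
passing from the Gaussian to the ball multiplies the coefficient of `t^m` by a number depending
only on `m`. -/
theorem setIntegral_norm_sub_pow [Nontrivial V] {D : ℕ} (hD : Module.finrank ℝ V = 2 * D) {R : ℝ}
    (hR : 0 < R) (k : ℕ) :
    ∫ p in Metric.ball 0 R ×ˢ Metric.ball 0 R, ‖p.1 - p.2‖ ^ (2 * k) ∂μ.prod μ =
      μ.real (Metric.ball 0 1) ^ 2 * (D.factorial * D.ascFactorial k * D.factorial : ℕ) *
        R ^ (4 * D + 2 * k) *
        ∑ j ∈ Finset.range (k + 1),
          (k.choose j : ℝ) / ((D + k - j).factorial * (D + j).factorial : ℕ) := by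
  set G : ℝ := ∫ p : V × V, ‖p.1‖ ^ (2 * k) * Real.exp (-‖p.1‖ ^ 2) * Real.exp (-‖p.2‖ ^ 2)
    ∂μ.prod μ with hG
  have hGv : G = μ.real (Metric.ball 0 1) ^ 2 *
      (D.factorial * D.ascFactorial k * D.factorial : ℕ) := by
    have h := integral_prod_mul (μ := μ) (ν := μ) (fun x : V => ‖x‖ ^ (2 * k) * Real.exp (-‖x‖ ^ 2))
      (fun y : V => ‖y‖ ^ (2 * 0) * Real.exp (-‖y‖ ^ 2))
    rw [integral_norm_pow_mul_gaussian μ hD, integral_norm_pow_mul_gaussian μ hD] at h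
    simp only [mul_zero, pow_zero, one_mul, Nat.ascFactorial_zero, mul_one] at h
    rw [hG, h]
    push_cast
    ring
  let J : (Σ _ : ℕ, ℕ) → ℝ := fun z => ∫ p : V × V, distMonomial z.2 (k - z.1 - z.2) z.1 p *
    Real.exp (-‖p.1‖ ^ 2) * Real.exp (-‖p.2‖ ^ 2) ∂μ.prod μ
  have hgauss : ∀ t : ℝ, ∑ z ∈ distIndex k,
      (distCoeff k z * J z) * t ^ (z.1 + 2 * (k - z.1 - z.2)) =
      ∑ j ∈ Finset.range (k + 1), (G * k.choose j) * t ^ (2 * j) := by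
    intro t
    have h := integral_norm_sub_smul_pow_mul_gaussian μ k t
    simp_rw [norm_sub_smul_pow_eq_sum, Finset.sum_mul] at h
    rw [integral_finsetSum] at h
    · simp_rw [mul_assoc, integral_const_mul, ← mul_assoc] at h
      calc _ = _ := Finset.sum_congr rfl fun z _ => by ring
        _ = _ := h
        _ = _ := by
          rw [add_comm (1 : ℝ), add_pow, Finset.sum_mul]
          refine Finset.sum_congr rfl fun j _ => ?_
          rw [← hG, one_pow, pow_mul]
          ring
    · intro z _
      have := (integrable_distMonomial_mul_gaussian μ z.2 (k - z.1 - z.2) z.1).const_mul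
        (distCoeff k z * t ^ (z.1 + 2 * (k - z.1 - z.2)))
      simpa only [← mul_assoc] using this
  -- the ratio of ball and Gaussian integrals for a monomial of bidegree `(2k - m, m)`
  let lam : ℕ → ℝ := fun m => R ^ (4 * D + 2 * k) /
    (Real.Gamma ((2 * D + (2 * k - m) : ℕ) / 2 + 1) * Real.Gamma ((2 * D + m : ℕ) / 2 + 1))
  have hball : ∀ z ∈ distIndex k,
      ∫ p in Metric.ball 0 R ×ˢ Metric.ball 0 R, distMonomial z.2 (k - z.1 - z.2) z.1 p ∂μ.prod μ =
        J z * lam (z.1 + 2 * (k - z.1 - z.2)) := by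
    intro z hz
    simp only [distIndex, Finset.mem_sigma, Finset.mem_range] at hz
    have h := pow_mul_integral_bihomogeneous_mul_gaussian μ (m₁ := 2 * z.2 + z.1)
      (m₂ := z.1 + 2 * (k - z.1 - z.2)) (q := distMonomial z.2 (k - z.1 - z.2) z.1)
      (fun r hr x y => by
        simp only [distMonomial, norm_smul, Real.norm_eq_abs, abs_of_pos hr, inner_smul_left,
          conj_trivial]
        ring)
      (fun r hr x y => by
        simp only [distMonomial, norm_smul, Real.norm_eq_abs, abs_of_pos hr, inner_smul_right]
        ring) hR (integrable_distMonomial_mul_gaussian μ _ _ _)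
      (integrableOn_ball_prod_ball μ (continuous_distMonomial _ _ _) R)
    rw [hD, ← pow_add, show 2 * D + (2 * z.2 + z.1) + (2 * D + (z.1 + 2 * (k - z.1 - z.2))) =
      4 * D + 2 * k by omega,
      show 2 * z.2 + z.1 = 2 * k - (z.1 + 2 * (k - z.1 - z.2)) by omega] at h
    have g1 : Real.Gamma ((2 * D + (2 * k - (z.1 + 2 * (k - z.1 - z.2))) : ℕ) / 2 + 1) ≠ 0 :=
      (Real.Gamma_pos_of_pos (by positivity)).ne'
    have g2 : Real.Gamma ((2 * D + (z.1 + 2 * (k - z.1 - z.2)) : ℕ) / 2 + 1) ≠ 0 :=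
      (Real.Gamma_pos_of_pos (by positivity)).ne'
    simp only [lam]
    rw [mul_div_assoc', eq_div_iff (mul_ne_zero g1 g2)]
    linear_combination -h
  calc
    _ = ∑ z ∈ distIndex k, (distCoeff k z * J z) * lam (z.1 + 2 * (k - z.1 - z.2)) := by
      have h1 : ∀ p : V × V, ‖p.1 - p.2‖ ^ (2 * k) = ∑ z ∈ distIndex k,
          distCoeff k z * distMonomial z.2 (k - z.1 - z.2) z.1 p := fun p => by
        simpa using norm_sub_smul_pow_eq_sum k 1 p
      simp_rw [h1]
      rw [integral_finsetSum]
      · refine Finset.sum_congr rfl fun z hz => ?_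
        rw [integral_const_mul, hball z hz, mul_assoc]
      · intro z _
        exact (integrableOn_ball_prod_ball μ (continuous_distMonomial _ _ _) R).const_mul _
    _ = ∑ j ∈ Finset.range (k + 1), (G * k.choose j) * lam (2 * j) :=
      sum_mul_eq_sum_mul_of_forall_sum_mul_pow_eq hgauss lam
    _ = _ := by
      rw [Finset.mul_sum]
      refine Finset.sum_congr rfl fun j hj => ?_
      have hj' : j ≤ k := Nat.lt_succ_iff.1 (Finset.mem_range.1 hj)
      have e1 : ((2 * D + (2 * k - 2 * j) : ℕ) : ℝ) / 2 = (D + k - j : ℕ) := by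
        rw [div_eq_iff two_ne_zero]
        exact_mod_cast (by omega : 2 * D + (2 * k - 2 * j) = (D + k - j) * 2)
      have e2 : ((2 * D + 2 * j : ℕ) : ℝ) / 2 = (D + j : ℕ) := by
        rw [div_eq_iff two_ne_zero]
        exact_mod_cast (by omega : 2 * D + 2 * j = (D + j) * 2)
      simp only [lam]
      rw [e1, e2, Real.Gamma_nat_eq_factorial, Real.Gamma_nat_eq_factorial, hGv]
      push_cast
      ring

end Moments

/-! ### Identification of the hypergeometric series -/

/-- Vandermonde's identity in factorial form. -/
theorem sum_choose_div_factorial_mul_factorial (D k : ℕ) :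
    ∑ j ∈ Finset.range (k + 1),
      (k.choose j : ℝ) / ((D + k - j).factorial * (D + j).factorial : ℕ) =
      (2 * D + 2 * k).factorial / ((D + k).factorial ^ 2 * (2 * D + k).factorial : ℕ) := by
  have hv := Nat.add_choose_eq (D + k) (D + k) k
  rw [Finset.Nat.sum_antidiagonal_eq_sum_range_succ
    (fun i j => (D + k).choose i * (D + k).choose j)] at hv
  have hv' := congrArg (Nat.cast : ℕ → ℝ) hv
  rw [Nat.cast_choose ℝ (by omega : k ≤ D + k + (D + k)),
    show D + k + (D + k) - k = 2 * D + k by omega,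
    show D + k + (D + k) = 2 * D + 2 * k by omega] at hv'
  push_cast at hv'
  have hk : (k.factorial : ℝ) ≠ 0 := by positivity
  have hDk : ((D + k).factorial : ℝ) ≠ 0 := by positivity
  have h : ∀ j ∈ Finset.range (k + 1),
      (k.choose j : ℝ) / ((D + k - j).factorial * (D + j).factorial : ℕ) =
        k.factorial / (D + k).factorial ^ 2 *
          (((D + k).choose j : ℝ) * ((D + k).choose (k - j) : ℝ)) := by
    intro j hj
    have hj' : j ≤ k := Nat.lt_succ_iff.1 (Finset.mem_range.1 hj)
    rw [Nat.cast_choose ℝ hj', Nat.cast_choose ℝ (by omega : j ≤ D + k),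
      Nat.cast_choose ℝ (by omega : k - j ≤ D + k), show D + k - (k - j) = D + j by omega]
    push_cast
    field_simp
  rw [Finset.sum_congr rfl h, ← Finset.mul_sum, ← hv']
  push_cast
  field_simp

theorem ascPochhammer_eval_natCast (n k : ℕ) :
    (ascPochhammer ℝ k).eval (n : ℝ) = n.ascFactorial k := by
  rw [← ascPochhammer_nat_eq_ascFactorial, ascPochhammer_eval_cast]

/-- The duplication formula for Pochhammer symbols. -/
theorem factorial_two_mul_add_two_mul (D k : ℕ) :
    ((2 * D + 2 * k).factorial : ℝ) = (2 * D).factorial * 4 ^ k *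
      (ascPochhammer ℝ k).eval (D + 1 / 2 : ℝ) * (ascPochhammer ℝ k).eval (D + 1 : ℝ) := by
  induction k with
  | zero => simp
  | succ k ih =>
    rw [show 2 * D + 2 * (k + 1) = 2 * D + 2 * k + 1 + 1 by ring, Nat.factorial_succ,
      Nat.factorial_succ, ascPochhammer_succ_eval, ascPochhammer_succ_eval]
    push_cast
    rw [ih]
    ring

/-- The factors coming from the Taylor series of `e^{-s}` and from the `2k`-th moment of the
distance combine to the `k`-th hypergeometric term. -/
theorem moment_coeff_eq_hypergeometric2F2Term (D k : ℕ) (R : ℝ) :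
    (-1) ^ k / (k.factorial : ℝ) * ((D.factorial * D.ascFactorial k * D.factorial : ℕ) *
        R ^ (2 * k) * ∑ j ∈ Finset.range (k + 1),
          (k.choose j : ℝ) / ((D + k - j).factorial * (D + j).factorial : ℕ)) =
      hypergeometric2F2Term D (D + 1 / 2) (D + 1) (2 * D + 1) (-4 * R ^ 2) k := by
  have h1 : ((D + k).factorial : ℝ) = D.factorial * (ascPochhammer ℝ k).eval (D + 1 : ℝ) := by
    have := ascPochhammer_eval_natCast (D + 1) k
    push_cast at this
    rw [this, ← Nat.cast_mul, Nat.factorial_mul_ascFactorial]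
  have h2 : ((2 * D + k).factorial : ℝ) =
      (2 * D).factorial * (ascPochhammer ℝ k).eval (2 * D + 1 : ℝ) := by
    have := ascPochhammer_eval_natCast (2 * D + 1) k
    push_cast at this
    rw [this, ← Nat.cast_mul, Nat.factorial_mul_ascFactorial]
  have p1 : (ascPochhammer ℝ k).eval (D + 1 : ℝ) ≠ 0 := (ascPochhammer_pos k _ (by positivity)).ne'
  have p2 : (ascPochhammer ℝ k).eval (2 * D + 1 : ℝ) ≠ 0 :=
    (ascPochhammer_pos k _ (by positivity)).ne'
  rw [sum_choose_div_factorial_mul_factorial, factorial_two_mul_add_two_mul,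
    hypergeometric2F2Term, ascPochhammer_eval_natCast]
  push_cast
  rw [h1, h2, show -4 * R ^ 2 = (-1) * 4 * R ^ 2 by ring, mul_pow, mul_pow, ← pow_mul]
  field_simp
  rw [neg_pow (4 : ℝ) k]
  ring

section Series

variable {V : Type*} [NormedAddCommGroup V] [InnerProductSpace ℝ V] [FiniteDimensional ℝ V]
  [MeasurableSpace V] [BorelSpace V] (μ : Measure V) [μ.IsAddHaarMeasure]

/-- The integral of `e^{-|x - y|²}` over a pair of balls is a `₂F₂` series. -/
theorem hasSum_hypergeometric2F2Term_setIntegral_exp [Nontrivial V] {D : ℕ}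
    (hD : Module.finrank ℝ V = 2 * D) {R : ℝ} (hR : 0 < R) :
    HasSum (fun k => μ.real (Metric.ball 0 1) ^ 2 * R ^ (4 * D) *
        hypergeometric2F2Term D (D + 1 / 2) (D + 1) (2 * D + 1) (-4 * R ^ 2) k)
      (∫ p in Metric.ball 0 R ×ˢ Metric.ball 0 R, Real.exp (-‖p.1 - p.2‖ ^ 2) ∂μ.prod μ) := by
  -- on the pair of balls `‖x - y‖ ≤ 2R`, so the `k`-th term is at most `(2R)^(2k) / k!`
  have h := hasSum_integral_of_dominated_convergence
    (μ := (μ.prod μ).restrict (Metric.ball 0 R ×ˢ Metric.ball 0 R))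
    (F := fun (k : ℕ) (p : V × V) => (-1) ^ k / (k.factorial : ℝ) * ‖p.1 - p.2‖ ^ (2 * k))
    (f := fun p => Real.exp (-‖p.1 - p.2‖ ^ 2))
    (fun k _ => ((2 * R) ^ 2) ^ k / (k.factorial : ℝ))
    (fun k => (by fun_prop : Continuous fun p : V × V =>
      (-1) ^ k / (k.factorial : ℝ) * ‖p.1 - p.2‖ ^ (2 * k)).aestronglyMeasurable)
    (fun k => by
      filter_upwards [ae_restrict_mem (Metric.isOpen_ball.measurableSet.prod
        Metric.isOpen_ball.measurableSet)] with p hp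
      have h1 : ‖p.1‖ < R := by simpa using hp.1
      have h2 : ‖p.2‖ < R := by simpa using hp.2
      rw [norm_mul, norm_div, norm_pow, norm_neg, norm_one, one_pow, norm_pow, norm_norm, pow_mul,
        RCLike.norm_natCast, one_div_mul_eq_div]
      gcongr
      linarith [norm_sub_le p.1 p.2])
    (.of_forall fun _ => Real.summable_pow_div_factorial _)
    (integrableOn_ball_prod_ball μ continuous_const R)
    (.of_forall fun p => by
      have := NormedSpace.expSeries_div_hasSum_exp (𝔸 := ℝ) (-‖p.1 - p.2‖ ^ 2)
      rw [← Real.exp_eq_exp_ℝ] at this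
      refine this.congr_fun fun k => ?_
      rw [neg_pow, pow_mul]
      ring)
  refine h.congr_fun fun k => ?_
  rw [integral_const_mul, setIntegral_norm_sub_pow μ hD hR, ← moment_coeff_eq_hypergeometric2F2Term]
  ring

end Series

/-! ### Lebesgue measure on `ℂ^D` -/

instance (D : ℕ) : (complexLebesgue D).IsAddHaarMeasure :=
  (EuclideanSpace.equiv (Fin D) ℂ).symm.isAddHaarMeasure_map _

theorem complexLebesgue_real_ball (D : ℕ) :
    (complexLebesgue D).real (Metric.ball 0 1) = Real.pi ^ D / D.factorial := by
  have h := Complex.volume_sum_rpow_lt_one (Fin D) (p := 2) (by norm_num)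
  have hm : Measurable (WithLp.toLp 2 : (Fin D → ℂ) → EuclideanSpace ℂ (Fin D)) :=
    (EuclideanSpace.equiv (Fin D) ℂ).symm.continuous.measurable
  have hs : (WithLp.toLp 2 : (Fin D → ℂ) → EuclideanSpace ℂ (Fin D)) ⁻¹' Metric.ball 0 1 =
      {x : Fin D → ℂ | ∑ i, ‖x i‖ ^ (2 : ℝ) < 1} := by
    ext x
    simp only [Set.mem_preimage, mem_ball_zero_iff, Set.mem_ofPred_eq, Real.rpow_two]
    rw [EuclideanSpace.norm_eq, Real.sqrt_lt' one_pos, one_pow]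
  rw [Measure.real, complexLebesgue, Measure.map_apply hm Metric.isOpen_ball.measurableSet, hs,
    ← volume_pi, h, ENNReal.toReal_ofReal (by positivity)]
  simp [Real.Gamma_nat_eq_factorial, one_add_one_eq_two]

theorem finrank_real_euclideanSpace_complex (D : ℕ) :
    Module.finrank ℝ (EuclideanSpace ℂ (Fin D)) = 2 * D := by
  rw [← Module.finrank_mul_finrank ℝ ℂ (EuclideanSpace ℂ (Fin D))]
  simp

/-! ### Factorial moments of counts -/

namespace Configuration

variable {S : Type*} [PseudoMetricSpace S]

/-- A bounded set contains finitely many points, counted with multiplicity. -/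
theorem finite_index (ξ : Configuration S) {A : Set S} (hA : Bornology.IsBounded A) :
    Finite {i : ξ.Index // i.1 ∈ A} := by
  have := (ξ.finite_of_isBounded A hA).to_subtype
  let f : {i : ξ.Index // i.1 ∈ A} → Σ x : {x ∈ A | ξ.mult x ≠ 0}, Fin (ξ.mult x) := fun i =>
    ⟨⟨i.1.1, i.2, fun h => (h ▸ i.1.2).elim0⟩, i.1.2⟩
  refine Finite.of_injective f fun i j h => ?_
  obtain ⟨⟨x, a⟩, hx⟩ := i
  obtain ⟨⟨y, b⟩, hy⟩ := j
  simp only [f, Sigma.mk.injEq, Subtype.mk.injEq] at h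
  obtain ⟨rfl, h⟩ := h
  cases h
  rfl

variable [MeasurableSpace S]

theorem measurable_measure_apply {A : Set S} (hA : MeasurableSet A) :
    Measurable fun ξ : Configuration S => ξ.measure A :=
  (Measure.measurable_coe hA).comp (comap_measurable _)

theorem measure_apply_eq_card (ξ : Configuration S) {A : Set S} (hA : MeasurableSet A)
    (hb : Bornology.IsBounded A) :
    ξ.measure A = (Nat.card {i : ξ.Index // i.1 ∈ A} : ENNReal) := by
  have := ξ.finite_index hb
  rw [measure, Measure.sum_apply _ hA]
  simp_rw [Measure.dirac_apply' _ hA]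
  calc ∑' i : ξ.Index, A.indicator (1 : S → ENNReal) i.1
      = ∑' i, {i : ξ.Index | i.1 ∈ A}.indicator (fun _ => (1 : ENNReal)) i := rfl
    _ = ∑' _ : {i : ξ.Index | i.1 ∈ A}, (1 : ENNReal) := (tsum_subtype _ _).symm
    _ = _ := by
      rw [ENNReal.tsum_const, mul_one]
      exact (congrArg _ (ENat.card_eq_coe_natCard {i : ξ.Index // i.1 ∈ A})).trans rfl

/-- The `n`-th factorial measure of `Aⁿ` counts the injections of `n` labels into the indices of
points in `A`. -/
theorem factorialMeasure_apply_pi (ξ : Configuration S) {A : Set S} (hA : MeasurableSet A)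
    (hb : Bornology.IsBounded A) (n : ℕ) :
    ξ.factorialMeasure n (Set.univ.pi fun _ => A) =
      ((Nat.card {i : ξ.Index // i.1 ∈ A}).descFactorial n : ENNReal) := by
  have := ξ.finite_index hb
  have hm : MeasurableSet (Set.univ.pi fun _ : Fin n => A) := MeasurableSet.univ_pi fun _ => hA
  rw [factorialMeasure, Measure.sum_apply _ hm]
  simp_rw [Measure.dirac_apply' _ hm]
  let T : Set (Fin n ↪ ξ.Index) := {e | ∀ j, (e j).1 ∈ A}
  let eqv : T ≃ (Fin n ↪ {i : ξ.Index // i.1 ∈ A}) :=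
    { toFun := fun e => ⟨fun j => ⟨e.1 j, e.2 j⟩, fun a b h => e.1.injective (congrArg (·.1) h)⟩
      invFun := fun e => ⟨e.trans (Function.Embedding.subtype _), fun j => (e j).2⟩
      left_inv := fun e => rfl
      right_inv := fun e => rfl }
  calc ∑' e : Fin n ↪ ξ.Index, (Set.univ.pi fun _ => A).indicator (1 : (Fin n → S) → ENNReal)
        (fun j => (e j).1)
      = ∑' e, T.indicator (fun _ => (1 : ENNReal)) e := by
        refine tsum_congr fun e => ?_
        by_cases h : e ∈ T
        · rw [Set.indicator_of_mem h, Set.indicator_of_mem (by simpa [T] using h)]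
          rfl
        · rw [Set.indicator_of_notMem h, Set.indicator_of_notMem (by simpa [T] using h)]
    _ = ∑' _ : T, (1 : ENNReal) := (tsum_subtype _ _).symm
    _ = _ := by
      have : Fintype {i : ξ.Index // i.1 ∈ A} := Fintype.ofFinite _
      rw [ENNReal.tsum_const, mul_one, ENat.card_congr eqv, ENat.card_eq_coe_fintype_card,
        Fintype.card_embedding_eq, Nat.card_eq_fintype_card, Fintype.card_fin]
      rfl

end Configuration

/-- The factorial moments of the number of points in a bounded set are integrals of the
correlation functions. -/
theorem IsCorrelationFunction.integral_descFactorial {S Ω : Type*} [PseudoMetricSpace S]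
    [ProperSpace S] [MeasurableSpace S] [MeasurableSpace Ω] {P : Measure Ω}
    {Ξ : Ω → Configuration S} {lam : Measure S} {n : ℕ} {ρ : (Fin n → S) → ℝ}
    (h : IsCorrelationFunction P Ξ lam n ρ) {A : Set S} (hA : MeasurableSet A)
    (hb : Bornology.IsBounded A) :
    Integrable (fun ω => ((Nat.card {i : (Ξ ω).Index // i.1 ∈ A}).descFactorial n : ℝ)) P ∧
    ∫ ω, ((Nat.card {i : (Ξ ω).Index // i.1 ∈ A}).descFactorial n : ℝ) ∂P =
      ∫ x in Set.univ.pi fun _ => A, ρ x ∂(Measure.pi fun _ => lam) := by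
  have hm : MeasurableSet (Set.univ.pi fun _ : Fin n => A) := MeasurableSet.univ_pi fun _ => hA
  let φ : (Fin n → S) → ℂ := (Set.univ.pi fun _ => A).indicator fun _ => 1
  have hφm : Measurable φ := measurable_const.indicator hm
  have hφb : ∃ C : ℝ, ∀ x, ‖φ x‖ ≤ C := ⟨1, fun x => by
    simp only [φ]
    exact (norm_indicator_le_norm_self _ _).trans (by simp)⟩
  have hφc : HasCompactSupport φ := by
    refine Metric.isCompact_of_isClosed_isBounded (isClosed_tsupport φ)
      (Bornology.IsBounded.closure (Bornology.IsBounded.subset (Bornology.IsBounded.pi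
        fun _ : Fin n => hb) ?_))
    exact Set.support_indicator_subset
  have hcount : ∀ ω, ∫ x, φ x ∂((Ξ ω).factorialMeasure n) =
      (((Nat.card {i : (Ξ ω).Index // i.1 ∈ A}).descFactorial n : ℝ) : ℂ) := by
    intro ω
    simp only [φ]
    rw [integral_indicator_const _ hm, Measure.real,
      Configuration.factorialMeasure_apply_pi _ hA hb]
    simp
  have hi := h.integrable_left φ hφm hφb hφc
  have he := h.integral_eq φ hφm hφb hφc
  simp_rw [hcount] at hi he
  have hi' := hi.re
  simp only [RCLike.re_to_complex, Complex.ofReal_re] at hi'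
  refine ⟨hi', ?_⟩
  rw [integral_complex_ofReal] at he
  have hr : ∀ x, φ x * (ρ x : ℂ) = (((Set.univ.pi fun _ => A).indicator ρ x : ℝ) : ℂ) := by
    intro x
    by_cases hx : x ∈ Set.univ.pi fun _ => A
    · simp only [φ, Set.indicator_of_mem hx, one_mul]
    · simp only [φ, Set.indicator_of_notMem hx, zero_mul, Complex.ofReal_zero]
  simp_rw [hr] at he
  rw [integral_complex_ofReal, integral_indicator hm] at he
  exact_mod_cast he

/-- Mean and variance of the number of points in a bounded set, from the first two correlation
functions. -/
theorem memLp_two_and_variance_of_isCorrelationFunction {S Ω : Type*} [PseudoMetricSpace S]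
    [ProperSpace S] [MeasurableSpace S] [MeasurableSpace Ω] {P : Measure Ω}
    [IsProbabilityMeasure P] {Ξ : Ω → Configuration S} (hΞ : Measurable Ξ) {lam : Measure S}
    {ρ₁ : (Fin 1 → S) → ℝ} {ρ₂ : (Fin 2 → S) → ℝ} (h₁ : IsCorrelationFunction P Ξ lam 1 ρ₁)
    (h₂ : IsCorrelationFunction P Ξ lam 2 ρ₂) {A : Set S} (hA : MeasurableSet A)
    (hb : Bornology.IsBounded A) :
    MemLp (fun ω => ((Ξ ω).measure A).toReal) 2 P ∧
    variance (fun ω => ((Ξ ω).measure A).toReal) P =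
      (∫ x in Set.univ.pi fun _ => A, ρ₂ x ∂(Measure.pi fun _ => lam)) +
        (∫ x in Set.univ.pi fun _ => A, ρ₁ x ∂(Measure.pi fun _ => lam)) -
        (∫ x in Set.univ.pi fun _ => A, ρ₁ x ∂(Measure.pi fun _ => lam)) ^ 2 := by
  obtain ⟨i1, e1⟩ := h₁.integral_descFactorial hA hb
  obtain ⟨i2, e2⟩ := h₂.integral_descFactorial hA hb
  have hN : ∀ ω, ((Ξ ω).measure A).toReal = (Nat.card {i : (Ξ ω).Index // i.1 ∈ A} : ℝ) :=
    fun ω => by rw [Configuration.measure_apply_eq_card _ hA hb, ENNReal.toReal_natCast]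
  have hmeas : Measurable fun ω => ((Ξ ω).measure A).toReal :=
    ((Configuration.measurable_measure_apply hA).comp hΞ).ennreal_toReal
  have hd1 : ∀ m : ℕ, (m.descFactorial 1 : ℝ) = m := fun m => by simp
  have hd2 : ∀ m : ℕ, (m.descFactorial 2 : ℝ) + m.descFactorial 1 = (m : ℝ) ^ 2 := by
    rintro (_ | m)
    · simp
    · simp [Nat.descFactorial_succ]
      ring
  have hsq : ∀ ω, ((Ξ ω).measure A).toReal ^ 2 =
      ((Nat.card {i : (Ξ ω).Index // i.1 ∈ A}).descFactorial 2 : ℝ) +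
        ((Nat.card {i : (Ξ ω).Index // i.1 ∈ A}).descFactorial 1 : ℝ) := fun ω => by
    rw [hN, hd2]
  have hL : MemLp (fun ω => ((Ξ ω).measure A).toReal) 2 P := by
    rw [memLp_two_iff_integrable_sq hmeas.aestronglyMeasurable]
    simp_rw [hsq]
    exact i2.add i1
  refine ⟨hL, ?_⟩
  have hsq' : (fun ω => ((Ξ ω).measure A).toReal) ^ 2 = _ := funext hsq
  rw [variance_eq_sub hL, ← e2, ← e1, ← integral_add i2 i1, hsq']
  simp only [hd1, hN]

/-! ### Correlation integrals of the Heisenberg process -/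

theorem ofReal_norm_sq_eq_sum {D : ℕ} (x : EuclideanSpace ℂ (Fin D)) :
    ((‖x‖ ^ 2 : ℝ) : ℂ) = ∑ l, x l * (starRingEnd ℂ) (x l) := by
  rw [EuclideanSpace.norm_sq_eq, Complex.ofReal_sum]
  exact Finset.sum_congr rfl fun l _ => by rw [Complex.mul_conj', Complex.ofReal_pow]

theorem heisenbergKernel_self {D : ℕ} (x : EuclideanSpace ℂ (Fin D)) :
    heisenbergKernel D x x = (Real.exp (‖x‖ ^ 2) : ℝ) := by
  rw [Complex.ofReal_exp, ofReal_norm_sq_eq_sum, heisenbergKernel]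

/-- The squared modulus of the kernel, `|K(x, y)|² = e^{2 Re (x · ȳ)}`, by polarization. -/
theorem heisenbergKernel_mul_heisenbergKernel_swap {D : ℕ} (x y : EuclideanSpace ℂ (Fin D)) :
    heisenbergKernel D x y * heisenbergKernel D y x =
      (Real.exp (‖x‖ ^ 2 + ‖y‖ ^ 2 - ‖x - y‖ ^ 2) : ℝ) := by
  rw [heisenbergKernel, heisenbergKernel, ← Complex.exp_add, Complex.ofReal_exp, Complex.ofReal_sub,
    Complex.ofReal_add, ofReal_norm_sq_eq_sum, ofReal_norm_sq_eq_sum, ofReal_norm_sq_eq_sum,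
    ← Finset.sum_add_distrib, ← Finset.sum_add_distrib, ← Finset.sum_sub_distrib]
  congr 1
  refine Finset.sum_congr rfl fun l _ => ?_
  rw [PiLp.sub_apply, map_sub]
  ring

theorem setIntegral_pi_fin_one {S : Type*} [MeasurableSpace S] (lam : Measure S)
    [SigmaFinite lam] (A : Set S) (f : (Fin 1 → S) → ℝ) :
    ∫ x in Set.univ.pi fun _ => A, f x ∂(Measure.pi fun _ => lam) =
      ∫ x in A, f (fun _ => x) ∂lam := by
  rw [← (measurePreserving_funUnique lam (Fin 1)).setIntegral_preimage_emb
    (MeasurableEquiv.measurableEmbedding _)]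
  have hs : (MeasurableEquiv.funUnique (Fin 1) S) ⁻¹' A = Set.univ.pi fun _ => A := by
    ext x
    simp [Fin.forall_fin_one]
  rw [hs]
  refine integral_congr_ae (.of_forall fun x => congrArg f (funext fun i => ?_))
  rw [Subsingleton.elim i default]
  rfl

theorem setIntegral_pi_fin_two {S : Type*} [MeasurableSpace S] (lam : Measure S)
    [SigmaFinite lam] (A : Set S) (f : (Fin 2 → S) → ℝ) :
    ∫ x in Set.univ.pi fun _ => A, f x ∂(Measure.pi fun _ => lam) =
      ∫ p in A ×ˢ A, f ![p.1, p.2] ∂(lam.prod lam) := by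
  rw [← (measurePreserving_finTwoArrow lam).setIntegral_preimage_emb
    (MeasurableEquiv.measurableEmbedding _)]
  have hs : MeasurableEquiv.finTwoArrow ⁻¹' (A ×ˢ A) = Set.univ.pi fun _ : Fin 2 => A := by
    ext x
    simp [Fin.forall_fin_two, MeasurableEquiv.finTwoArrow]
  rw [hs]
  refine integral_congr_ae (.of_forall fun x => congrArg f (funext fun i => ?_))
  fin_cases i <;> rfl

section Heisenberg

variable (D : ℕ)

instance : SigmaFinite (complexGaussian D) := SigmaFinite.withDensity_ofReal _

theorem complexLebesgue_real_ball_of_pos {R : ℝ} (hR : 0 < R) :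
    (complexLebesgue D).real (Metric.ball 0 R) = R ^ (2 * D) * (Real.pi ^ D / D.factorial) := by
  rw [← complexLebesgue_real_ball, Measure.real, Measure.addHaar_ball_of_pos _ _ hR,
    finrank_real_euclideanSpace_complex, ENNReal.toReal_mul, ENNReal.toReal_ofReal (by positivity),
    Measure.real]

theorem measurable_gaussianDensity : Measurable fun x : EuclideanSpace ℂ (Fin D) =>
    ENNReal.ofReal (Real.exp (-‖x‖ ^ 2) / Real.pi ^ D) := by
  fun_prop

/-- The mean number of points in a ball: the density of the one-point intensity with respect to
Lebesgue measure is the constant `π^{-D}`. -/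
theorem setIntegral_exp_norm_sq_complexGaussian {R : ℝ} (hR : 0 < R) :
    ∫ x in Metric.ball 0 R, Real.exp (‖x‖ ^ 2) ∂complexGaussian D =
      R ^ (2 * D) / D.factorial := by
  rw [complexGaussian, setIntegral_withDensity_eq_setIntegral_toReal_smul
    (measurable_gaussianDensity D) (.of_forall fun _ => ENNReal.ofReal_lt_top) _
    Metric.isOpen_ball.measurableSet]
  have h : ∀ x : EuclideanSpace ℂ (Fin D),
      (ENNReal.ofReal (Real.exp (-‖x‖ ^ 2) / Real.pi ^ D)).toReal • Real.exp (‖x‖ ^ 2) =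
        (Real.pi ^ D)⁻¹ := by
    intro x
    rw [ENNReal.toReal_ofReal (by positivity), smul_eq_mul, div_mul_eq_mul_div, ← Real.exp_add,
      neg_add_cancel, Real.exp_zero, one_div]
  simp_rw [h]
  rw [setIntegral_const, complexLebesgue_real_ball_of_pos D hR, smul_eq_mul]
  have : Real.pi ^ D ≠ 0 := by positivity
  field_simp

/-- The density of the two-point intensity with respect to Lebesgue measure is
`π^{-2D} (1 - e^{-|x - y|²})`. -/
theorem setIntegral_two_point_complexGaussian {R : ℝ} (hR : 0 < R) :
    ∫ p in Metric.ball 0 R ×ˢ Metric.ball 0 R, (Real.exp (‖p.1‖ ^ 2) * Real.exp (‖p.2‖ ^ 2) -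
        Real.exp (‖p.1‖ ^ 2 + ‖p.2‖ ^ 2 - ‖p.1 - p.2‖ ^ 2))
        ∂(complexGaussian D).prod (complexGaussian D) =
      (R ^ (2 * D) / D.factorial) ^ 2 - (Real.pi ^ D)⁻¹ ^ 2 *
        ∫ p in Metric.ball 0 R ×ˢ Metric.ball 0 R, Real.exp (-‖p.1 - p.2‖ ^ 2)
          ∂(complexLebesgue D).prod (complexLebesgue D) := by
  have hm := measurable_gaussianDensity D
  rw [complexGaussian, prod_withDensity hm hm, setIntegral_withDensity_eq_setIntegral_toReal_smul
    (f := fun z : EuclideanSpace ℂ (Fin D) × EuclideanSpace ℂ (Fin D) =>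
      ENNReal.ofReal (Real.exp (-‖z.1‖ ^ 2) / Real.pi ^ D) *
        ENNReal.ofReal (Real.exp (-‖z.2‖ ^ 2) / Real.pi ^ D))
    ((hm.comp measurable_fst).mul (hm.comp measurable_snd))
    (.of_forall fun _ => ENNReal.mul_lt_top ENNReal.ofReal_lt_top ENNReal.ofReal_lt_top) _
    (Metric.isOpen_ball.measurableSet.prod Metric.isOpen_ball.measurableSet)]
  have h : ∀ p : EuclideanSpace ℂ (Fin D) × EuclideanSpace ℂ (Fin D),
      (ENNReal.ofReal (Real.exp (-‖p.1‖ ^ 2) / Real.pi ^ D) *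
        ENNReal.ofReal (Real.exp (-‖p.2‖ ^ 2) / Real.pi ^ D)).toReal •
        (Real.exp (‖p.1‖ ^ 2) * Real.exp (‖p.2‖ ^ 2) -
          Real.exp (‖p.1‖ ^ 2 + ‖p.2‖ ^ 2 - ‖p.1 - p.2‖ ^ 2)) =
        (Real.pi ^ D)⁻¹ ^ 2 - (Real.pi ^ D)⁻¹ ^ 2 * Real.exp (-‖p.1 - p.2‖ ^ 2) := by
    intro p
    rw [ENNReal.toReal_mul, ENNReal.toReal_ofReal (by positivity),
      ENNReal.toReal_ofReal (by positivity), smul_eq_mul, sub_eq_add_neg (_ + _), Real.exp_add,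
      Real.exp_add, Real.exp_neg, Real.exp_neg]
    field_simp
  simp_rw [h]
  rw [integral_sub, integral_const_mul, setIntegral_const, Measure.real, Measure.prod_prod,
    ENNReal.toReal_mul, ← Measure.real, complexLebesgue_real_ball_of_pos D hR, smul_eq_mul]
  · have : Real.pi ^ D ≠ 0 := by positivity
    field_simp
  · exact integrableOn_ball_prod_ball _ continuous_const R
  · exact integrableOn_ball_prod_ball _ (by fun_prop) R

end Heisenberg

/-! ### The variance of the number of points in a ball -/

theorem mainTheorem5 (D : ℕ) (hD : 1 ≤ D) {Ω : Type*} [MeasurableSpace Ω] (P : Measure Ω)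
    [IsProbabilityMeasure P] (Ξ : Ω → Configuration (EuclideanSpace ℂ (Fin D)))
    (hΞ : IsHeisenbergDPP D P Ξ) (R : ℝ) (hR : 0 < R) :
    MemLp (fun ω => ((Ξ ω).measure (Metric.ball 0 R)).toReal) 2 P ∧
    Summable (hypergeometric2F2Term D (D + 1 / 2) (D + 1) (2 * D + 1) (-4 * R ^ 2)) ∧
    variance (fun ω => ((Ξ ω).measure (Metric.ball 0 R)).toReal) P =
      R ^ (2 * D) / Real.Gamma (D + 1) *
        (1 - R ^ (2 * D) / Real.Gamma (D + 1) *
          hypergeometric2F2 D (D + 1 / 2) (D + 1) (2 * D + 1) (-4 * R ^ 2)) := by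
  obtain ⟨ρ₁, h₁, hρ₁⟩ := hΞ.correlation 1 le_rfl
  obtain ⟨ρ₂, h₂, hρ₂⟩ := hΞ.correlation 2 one_le_two
  have : Nontrivial (EuclideanSpace ℂ (Fin D)) :=
    Module.nontrivial_of_finrank_pos (R := ℝ) (by
      rw [finrank_real_euclideanSpace_complex]
      omega)
  obtain ⟨hL, hvar⟩ := memLp_two_and_variance_of_isCorrelationFunction hΞ.measurable h₁ h₂
    (A := Metric.ball 0 R) Metric.isOpen_ball.measurableSet Metric.isBounded_ball
  have hs := hasSum_hypergeometric2F2Term_setIntegral_exp (complexLebesgue D)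
    (finrank_real_euclideanSpace_complex D) hR
  rw [complexLebesgue_real_ball] at hs
  have hc : (Real.pi ^ D / D.factorial : ℝ) ^ 2 * R ^ (4 * D) ≠ 0 := by positivity
  refine ⟨hL, (summable_mul_left_iff hc).1 hs.summable, ?_⟩
  have hF := hs.tsum_eq
  rw [tsum_mul_left] at hF
  change _ * hypergeometric2F2 _ _ _ _ _ = _ at hF
  have e₁ : ∀ x : EuclideanSpace ℂ (Fin D), ρ₁ (fun _ => x) = Real.exp (‖x‖ ^ 2) := fun x => by
    have := hρ₁ fun _ => x
    rw [Matrix.det_fin_one, Matrix.of_apply, heisenbergKernel_self] at this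
    exact_mod_cast this
  have e₂ : ∀ p : EuclideanSpace ℂ (Fin D) × EuclideanSpace ℂ (Fin D), ρ₂ ![p.1, p.2] =
      Real.exp (‖p.1‖ ^ 2) * Real.exp (‖p.2‖ ^ 2) -
        Real.exp (‖p.1‖ ^ 2 + ‖p.2‖ ^ 2 - ‖p.1 - p.2‖ ^ 2) := fun p => by
    have := hρ₂ ![p.1, p.2]
    simp only [Matrix.det_fin_two, Matrix.of_apply, Matrix.cons_val_zero, Matrix.cons_val_one,
      heisenbergKernel_self, heisenbergKernel_mul_heisenbergKernel_swap] at this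
    exact_mod_cast this
  rw [hvar, setIntegral_pi_fin_one, setIntegral_pi_fin_two]
  simp_rw [e₁, e₂]
  rw [setIntegral_exp_norm_sq_complexGaussian D hR, setIntegral_two_point_complexGaussian D hR,
    ← hF, Real.Gamma_nat_eq_factorial]
  have : Real.pi ^ D ≠ 0 := by positivity
  field_simp
  ring
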